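/- Let $\Omega\subset\mathbb{R}^d$ be an open set with an outer unit normal $n(z)$ at almost every $z\in\partial\Omega$ with respect to $(d-1)$-dimensional Hausdorff measure, and let $F$ be a finite-dimensional real inner product space (for instance $F=\mathbb{R}$ or $F=\mathbb{R}^d$). Let $L^2(\Omega)$ be the space of square-integrable functions $\Omega\to F$ with $\langle u,v\rangle_{L^2}=\int_\Omega \langle u(y),v(y)\rangle\,dy$, and let $H^1(\Omega)$ be the space of those $u\in L^2(\Omega)$ whose weak partial derivatives $\partial_1u,\dots,\partial_du$ belong to $L^2(\Omega)$, with $\langle u,v\rangle_{H^1}=\int_\Omega \langle u(y),v(y)\rangle\,dy+\int_\Omega\sum_{i=1}^d\langle\partial_iu(y),\partial_iv(y)\rangle\,dy$. Let $f:H^1(\Omega)\to\mathbb{R}$ and $x\in H^1(\Omega)$ be such that the directional derivative $Df(x;v)=\lim_{\varepsilon\to0}\frac{f(x+\varepsilon v)-f(x)}{\varepsilon}$ exists for every $v\in H^1(\Omega)$. Let $\nabla^{L}f\in L^2(\Omega)$ and $\nabla^{H}f\in H^1(\Omega)$ be the $L^2$ gradient and the $H^1$ (Sobolev) gradient of $f$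 at $x$, that is, $$Df(x;v)=\langle\nabla^{L}f,v\rangle_{L^2}=\langle\nabla^{H}f,v\rangle_{H^1}\qquad\text{for all }v\in H^1(\Omega).$$ Suppose that $\frac{\partial}{\partial n}\nabla^{H}f=0$ almost everywhere on $\partial\Omega$, the boundary values being taken in the trace sense: for almost every $z\in\partial\Omega$, the mean value of $\big|\sum_i n_i(z)\,\partial_i(\nabla^{H}f)\big|$ over $B(z,r)\cap\Omega$ tends to $0$ as $r\to0$. Then the weak Laplacian $\Delta\nabla^{H}f$ exists in $L^2(\Omega)$, and $$(I-\Delta)\nabla^{H}f=\nabla^{L}f\qquad\text{almost everywhere on }\Omega.$$ -/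

import Mathlib

open MeasureTheory Filter Topology
open scoped ContDiff Laplacian

noncomputable section

namespace SobolevSmoothing

variable {d : ℕ} {F : Type*} [NormedAddCommGroup F] [InnerProductSpace ℝ F]

/-- Test functions on `Ω`: smooth real functions whose support is a compact subset of `Ω`. -/
structure IsTestFunction (Ω : Set (EuclideanSpace ℝ (Fin d))) (φ : EuclideanSpace ℝ (Fin d) → ℝ) :
    Prop where
  smooth : ContDiff ℝ ∞ φ
  compact : HasCompactSupport φ
  subset : tsupport φ ⊆ Ω

variable (F) in
/-- The Hilbert space `L²(Ω; F)` of square-integrable functions `Ω → F`, up to equality almost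
everywhere, with inner product `⟪u, v⟫ = ∫_Ω ⟪u(y), v(y)⟫ dy`. -/
abbrev L2 (Ω : Set (EuclideanSpace ℝ (Fin d))) : Type _ :=
  Lp F 2 ((volume : Measure (EuclideanSpace ℝ (Fin d))).restrict Ω)

/-- `w` is the weak partial derivative `∂ᵢ u` on `Ω`. -/
def IsWeakPartial (Ω : Set (EuclideanSpace ℝ (Fin d))) (i : Fin d) (u w : L2 F Ω) : Prop :=
  ∀ φ : EuclideanSpace ℝ (Fin d) → ℝ, IsTestFunction Ω φ →
    ∫ y in Ω, lineDeriv ℝ φ y (EuclideanSpace.single i 1) • u y = -∫ y in Ω, φ y • w y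

/-- `w` is the weak (distributional) Laplacian `Δ u` on `Ω`. -/
def IsWeakLaplacian (Ω : Set (EuclideanSpace ℝ (Fin d))) (u w : L2 F Ω) : Prop :=
  ∀ φ : EuclideanSpace ℝ (Fin d) → ℝ, IsTestFunction Ω φ →
    ∫ y in Ω, Δ φ y • u y = ∫ y in Ω, φ y • w y

lemma IsTestFunction.lineDeriv {Ω : Set (EuclideanSpace ℝ (Fin d))}
    {φ : EuclideanSpace ℝ (Fin d) → ℝ} (h : IsTestFunction Ω φ) (e : EuclideanSpace ℝ (Fin d)) :
    IsTestFunction Ω (fun y => lineDeriv ℝ φ y e) := by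
  have h1 : (fun y => _root_.lineDeriv ℝ φ y e) = fun y => fderiv ℝ φ y e := by
    funext y
    exact (h.smooth.differentiable (by simp) y).lineDeriv_eq_fderiv
  have h2 : tsupport (fun y => fderiv ℝ φ y e) ⊆ tsupport φ :=
    tsupport_fderiv_apply_subset ℝ e
  rw [h1]
  refine ⟨?_, ?_, h2.trans h.subset⟩
  · exact (h.smooth.fderiv_right (m := ∞) (by simp)).clm_apply contDiff_const
  · exact h.compact.of_isClosed_subset (isClosed_tsupport _) h2

lemma IsTestFunction.integrable_smul {Ω : Set (EuclideanSpace ℝ (Fin d))}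
    {φ : EuclideanSpace ℝ (Fin d) → ℝ} (h : IsTestFunction Ω φ) (u : L2 F Ω) :
    Integrable (fun y => φ y • u y) (volume.restrict Ω) := by
  have h1 : MemLp φ 2 ((volume : Measure (EuclideanSpace ℝ (Fin d))).restrict Ω) :=
    (h.smooth.continuous.memLp_of_hasCompactSupport h.compact).restrict Ω
  have h2 := (Lp.memLp u).smul (r := 1) h1
  exact memLp_one_iff_integrable.1 h2

lemma IsWeakPartial.zero (Ω : Set (EuclideanSpace ℝ (Fin d))) (i : Fin d) :
    IsWeakPartial Ω i (0 : L2 F Ω) 0 := by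
  intro φ _
  have h0 := Lp.coeFn_zero F 2 ((volume : Measure (EuclideanSpace ℝ (Fin d))).restrict Ω)
  rw [integral_eq_zero_of_ae, integral_eq_zero_of_ae, neg_zero]
  · filter_upwards [h0] with y hy
    rw [hy]; simp
  · filter_upwards [h0] with y hy
    rw [hy]; simp

lemma IsWeakPartial.add {Ω : Set (EuclideanSpace ℝ (Fin d))} {i : Fin d} {u u' w w' : L2 F Ω}
    (h : IsWeakPartial Ω i u w) (h' : IsWeakPartial Ω i u' w') :
    IsWeakPartial Ω i (u + u') (w + w') := by
  have key : ∀ (ψ : EuclideanSpace ℝ (Fin d) → ℝ), IsTestFunction Ω ψ → ∀ a b : L2 F Ω,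
      ∫ y in Ω, ψ y • (a + b : L2 F Ω) y = (∫ y in Ω, ψ y • a y) + ∫ y in Ω, ψ y • b y := by
    intro ψ hψ a b
    rw [← integral_add (hψ.integrable_smul a) (hψ.integrable_smul b)]
    refine integral_congr_ae ?_
    filter_upwards [Lp.coeFn_add a b] with y hy
    rw [hy, Pi.add_apply, smul_add]
  intro φ hφ
  rw [key _ (hφ.lineDeriv _), key _ hφ, h φ hφ, h' φ hφ, neg_add]

lemma IsWeakPartial.smul {Ω : Set (EuclideanSpace ℝ (Fin d))} {i : Fin d} {u w : L2 F Ω}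
    (c : ℝ) (h : IsWeakPartial Ω i u w) : IsWeakPartial Ω i (c • u) (c • w) := by
  have key : ∀ (ψ : EuclideanSpace ℝ (Fin d) → ℝ), ∀ a : L2 F Ω,
      ∫ y in Ω, ψ y • (c • a : L2 F Ω) y = c • ∫ y in Ω, ψ y • a y := by
    intro ψ a
    rw [← integral_smul]
    refine integral_congr_ae ?_
    filter_upwards [Lp.coeFn_smul c a] with y hy
    rw [hy, Pi.smul_apply, smul_comm]
  intro φ hφ
  rw [key, key, h φ hφ, smul_neg]

variable (F) in
/-- The Sobolev space `H¹(Ω; F)`: the functions in `L²(Ω; F)` all of whose weak partial derivatives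
exist in `L²(Ω; F)`. -/
def H1 (Ω : Set (EuclideanSpace ℝ (Fin d))) : Submodule ℝ (L2 F Ω) where
  carrier := {u | ∀ i, ∃ w : L2 F Ω, IsWeakPartial Ω i u w}
  zero_mem' i := ⟨0, IsWeakPartial.zero Ω i⟩
  add_mem' hu hv i := by
    obtain ⟨w, hw⟩ := hu i
    obtain ⟨w', hw'⟩ := hv i
    exact ⟨w + w', hw.add hw'⟩
  smul_mem' c _ hu i := by
    obtain ⟨w, hw⟩ := hu i
    exact ⟨c • w, hw.smul c⟩

/-- The weak partial derivative `∂ᵢ u` of `u ∈ H¹(Ω; F)`; it is unique when `Ω` is open. -/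
def weakPartial {Ω : Set (EuclideanSpace ℝ (Fin d))} (i : Fin d) (u : H1 F Ω) : L2 F Ω :=
  (u.2 i).choose

lemma isWeakPartial_weakPartial {Ω : Set (EuclideanSpace ℝ (Fin d))} (i : Fin d) (u : H1 F Ω) :
    IsWeakPartial Ω i (u : L2 F Ω) (weakPartial i u) :=
  (u.2 i).choose_spec

/-- The inner product of `H¹(Ω; F)`: `∫_Ω ⟪u, v⟫ + ∫_Ω ⟪∇u, ∇v⟫`. -/
def h1Inner {Ω : Set (EuclideanSpace ℝ (Fin d))} (u v : H1 F Ω) : ℝ :=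
  (∫ y in Ω, inner ℝ ((u : L2 F Ω) y) ((v : L2 F Ω) y)) +
    ∫ y in Ω, ∑ i, inner ℝ (weakPartial i u y) (weakPartial i v y)

/-- `g ∈ L²(Ω; F)` is the `L²` gradient at `x` of the functional `f` on `H¹(Ω; F)`: it represents
the directional derivative `v ↦ Df(x; v)` through the `L²` inner product. -/
def IsL2Gradient {Ω : Set (EuclideanSpace ℝ (Fin d))} (f : H1 F Ω → ℝ) (x : H1 F Ω) (g : L2 F Ω) :
    Prop :=
  ∀ v : H1 F Ω, HasLineDerivAt ℝ f (∫ y in Ω, inner ℝ (g y) ((v : L2 F Ω) y)) x v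

/-- `g ∈ H¹(Ω; F)` is the `H¹` (Sobolev) gradient at `x` of the functional `f` on `H¹(Ω; F)`: it
represents the directional derivative `v ↦ Df(x; v)` through the `H¹` inner product. -/
def IsH1Gradient {Ω : Set (EuclideanSpace ℝ (Fin d))} (f : H1 F Ω → ℝ) (x g : H1 F Ω) : Prop :=
  ∀ v : H1 F Ω, HasLineDerivAt ℝ f (h1Inner g v) x v

/-- `ν` is the outer unit normal of `Ω` at the boundary point `x`: near `x`, up to an arbitrarily
thin cone around the hyperplane through `x` orthogonal to `ν`, the points on the side of `-ν` are in
`Ω` and those on the side of `ν` are not. -/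
def IsOuterUnitNormal (Ω : Set (EuclideanSpace ℝ (Fin d))) (x ν : EuclideanSpace ℝ (Fin d)) :
    Prop :=
  x ∈ frontier Ω ∧ ‖ν‖ = 1 ∧ ∀ ε > (0 : ℝ), ∀ᶠ y in 𝓝 x,
    (inner ℝ (y - x) ν < -(ε * ‖y - x‖) → y ∈ Ω) ∧ (ε * ‖y - x‖ < inner ℝ (y - x) ν → y ∉ Ω)

/-- The function `u` on `Ω` has the boundary value (trace) `a` at the boundary point `x`, in the
sense of Lebesgue: the mean of `‖u - a‖` over `B(x, r) ∩ Ω` tends to zero with `r`. On a Lipschitz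
domain the trace of a Sobolev function has this property at almost every boundary point. -/
def HasTraceAt (Ω : Set (EuclideanSpace ℝ (Fin d))) (u : EuclideanSpace ℝ (Fin d) → F) (a : F)
    (x : EuclideanSpace ℝ (Fin d)) : Prop :=
  Tendsto (fun r : ℝ => ⨍ y in Metric.ball x r ∩ Ω, ‖u y - a‖) (𝓝[>] 0) (𝓝 0)

/-- `u ∈ H¹(Ω; F)` has the normal derivative `∂u/∂ν = a` at the boundary point `x`, where `ν` is the
outer unit normal there: `∑ᵢ νᵢ ∂ᵢu` has the trace `a` at `x`. -/
def HasNormalDerivAt {Ω : Set (EuclideanSpace ℝ (Fin d))} (u : H1 F Ω) (a : F)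
    (x ν : EuclideanSpace ℝ (Fin d)) : Prop :=
  HasTraceAt Ω (fun y => ∑ i, ν i • weakPartial i u y) a x

/-- Surface measure on the boundary of `Ω`: `(d-1)`-dimensional Hausdorff measure. -/
def surfaceMeasure (Ω : Set (EuclideanSpace ℝ (Fin d))) : Measure (EuclideanSpace ℝ (Fin d)) :=
  (Measure.hausdorffMeasure ((d : ℝ) - 1)).restrict (frontier Ω)

end SobolevSmoothing

end

noncomputable section

namespace SobolevSmoothing

variable {d : ℕ} {F : Type*} [NormedAddCommGroup F] [InnerProductSpace ℝ F]

/-! A directional derivative is unique, so the two gradients pair equally with every `v` in `H1 F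
Ω`, one through the `H¹` product and the other through `L²`. It is enough to take `v = φ • e` with
`φ` a test function and `e` a fixed vector. The support of `φ` is compact in `Ω`, so no boundary
term arises, and the weak partials of `v` are `∂ᵢφ • e`. Testing `∂ᵢu` against `∂ᵢφ`, itself a test
function, moves the derivative off `u`; summing over `i` turns the gradient term into `-⟪e, ∫ Δφ •
u⟫` (`IsTestFunction.h1Inner_toH1`). As `e` and `φ` vary, this says `Δu = u - g` weakly, with `u`
the `H¹` and `g` the `L²` gradient. -/

lemma IsTestFunction.lineDeriv_eq_fderiv {Ω : Set (EuclideanSpace ℝ (Fin d))}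
    {φ : EuclideanSpace ℝ (Fin d) → ℝ} (h : IsTestFunction Ω φ) (y e : EuclideanSpace ℝ (Fin d)) :
    _root_.lineDeriv ℝ φ y e = fderiv ℝ φ y e :=
  (h.smooth.differentiable (by simp) y).lineDeriv_eq_fderiv

lemma IsTestFunction.setIntegral_smul {Ω : Set (EuclideanSpace ℝ (Fin d))}
    {φ : EuclideanSpace ℝ (Fin d) → ℝ} (h : IsTestFunction Ω φ)
    (u : EuclideanSpace ℝ (Fin d) → F) :
    ∫ y in Ω, φ y • u y = ∫ y, φ y • u y := by
  refine setIntegral_eq_integral_of_forall_compl_eq_zero fun y hy => ?_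
  rw [image_eq_zero_of_notMem_tsupport fun hy' => hy (h.subset hy'), zero_smul]

/-- Puts `Δ φ` in the form of iterated derivatives that `IsWeakPartial` can absorb one at a time. -/
lemma IsTestFunction.laplacian_eq_sum_lineDeriv {Ω : Set (EuclideanSpace ℝ (Fin d))}
    {φ : EuclideanSpace ℝ (Fin d) → ℝ} (h : IsTestFunction Ω φ) (y : EuclideanSpace ℝ (Fin d)) :
    Δ φ y = ∑ i, _root_.lineDeriv ℝ
      (fun z => _root_.lineDeriv ℝ φ z (EuclideanSpace.single i 1)) y
        (EuclideanSpace.single i 1) := by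
  rw [InnerProductSpace.laplacian_eq_iteratedFDeriv_orthonormalBasis φ
    (EuclideanSpace.basisFun (Fin d) ℝ)]
  refine Finset.sum_congr rfl fun i _ => ?_
  rw [(h.lineDeriv _).lineDeriv_eq_fderiv]
  simp_rw [h.lineDeriv_eq_fderiv, iteratedFDeriv_two_apply]
  rw [fderiv_clm_apply
    ((h.smooth.fderiv_right (m := ∞) (by simp)).differentiable (by simp) y)
    (differentiableAt_const _)]
  simp

/-- Weak partial derivatives on an open set are unique. -/
lemma IsWeakPartial.unique [CompleteSpace F] {Ω : Set (EuclideanSpace ℝ (Fin d))} (hΩ : IsOpen Ω)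
    {i : Fin d} {u w w' : L2 F Ω} (h : IsWeakPartial Ω i u w) (h' : IsWeakPartial Ω i u w') :
    w = w' := by
  have hloc : LocallyIntegrableOn (fun y => w y - w' y) Ω volume := by
    have : ∀ a : L2 F Ω, LocallyIntegrableOn a Ω volume := fun a =>
      locallyIntegrableOn_of_locallyIntegrable_restrict
        ((Lp.memLp a).locallyIntegrable (by norm_num))
    exact (this w).sub (this w')
  -- Fundamental lemma of the calculus of variations: `w` and `w'` have the same integral against
  -- each `φ`, namely `-∫ ∂ᵢφ • u`.
  have hzero := hΩ.ae_eq_zero_of_integral_contDiff_smul_eq_zero hloc fun φ h1 h2 h3 => by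
    have hφ : IsTestFunction Ω φ := ⟨h1, h2, h3⟩
    rw [← hφ.setIntegral_smul]
    simp_rw [smul_sub]
    rw [integral_sub (hφ.integrable_smul w) (hφ.integrable_smul w'), sub_eq_zero]
    exact neg_injective ((h φ hφ).symm.trans (h' φ hφ))
  refine Lp.ext ?_
  filter_upwards [(ae_restrict_iff' hΩ.measurableSet).2 hzero] with y hy
  exact sub_eq_zero.1 hy

lemma IsTestFunction.memLp_smul_const {Ω : Set (EuclideanSpace ℝ (Fin d))}
    {φ : EuclideanSpace ℝ (Fin d) → ℝ} (h : IsTestFunction Ω φ) (e : F) :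
    MemLp (fun y => φ y • e) 2 ((volume : Measure (EuclideanSpace ℝ (Fin d))).restrict Ω) := by
  have hc : Continuous fun y => φ y • e := h.smooth.continuous.smul continuous_const
  exact (hc.memLp_of_hasCompactSupport h.compact.smul_right).restrict Ω

/-- The class in `L²(Ω; F)` of the function `y ↦ φ y • e`. -/
def IsTestFunction.smulConst {Ω : Set (EuclideanSpace ℝ (Fin d))}
    {φ : EuclideanSpace ℝ (Fin d) → ℝ} (h : IsTestFunction Ω φ) (e : F) : L2 F Ω :=
  (h.memLp_smul_const e).toLp _

lemma IsTestFunction.coeFn_smulConst {Ω : Set (EuclideanSpace ℝ (Fin d))}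
    {φ : EuclideanSpace ℝ (Fin d) → ℝ} (h : IsTestFunction Ω φ) (e : F) :
    h.smulConst e =ᵐ[volume.restrict Ω] fun y => φ y • e :=
  MemLp.coeFn_toLp _

lemma IsTestFunction.isWeakPartial_smulConst [CompleteSpace F]
    {Ω : Set (EuclideanSpace ℝ (Fin d))}
    {φ : EuclideanSpace ℝ (Fin d) → ℝ} (h : IsTestFunction Ω φ) (e : F) (i : Fin d) :
    IsWeakPartial Ω i (h.smulConst e)
      ((h.lineDeriv (EuclideanSpace.single i 1)).smulConst e) := by
  intro ψ hψ
  have hcongr : ∀ {η χ : EuclideanSpace ℝ (Fin d) → ℝ} (hη : IsTestFunction Ω η)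
      (hχ : IsTestFunction Ω χ),
      ∫ y in Ω, χ y • hη.smulConst e y = (∫ y, χ y * η y) • e := by
    intro η χ hη hχ
    rw [← integral_smul_const]
    simp_rw [mul_smul]
    rw [← hχ.setIntegral_smul]
    refine integral_congr_ae ?_
    filter_upwards [hη.coeFn_smulConst e] with y hy
    rw [hy]
  have hint : ∀ {η χ : EuclideanSpace ℝ (Fin d) → ℝ}, IsTestFunction Ω η →
      IsTestFunction Ω χ → Integrable fun y => χ y * η y := fun hη hχ =>
    (hχ.smooth.continuous.mul hη.smooth.continuous).integrable_of_hasCompactSupport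
      hχ.compact.mul_right
  have h1 := hint h (hψ.lineDeriv (EuclideanSpace.single i 1))
  have h2 := hint (h.lineDeriv (EuclideanSpace.single i 1)) hψ
  -- Both factors are smooth with compact support in `Ω`, so integration by parts takes place on the
  -- whole space.
  have hparts := integral_mul_fderiv_eq_neg_fderiv_mul_of_integrable (μ := volume)
    (by simpa only [hψ.lineDeriv_eq_fderiv] using h1)
    (by simpa only [h.lineDeriv_eq_fderiv] using h2) (hint h hψ)
    (fun y _ => hψ.smooth.differentiable (by simp) y)
    (fun y _ => h.smooth.differentiable (by simp) y)
  rw [hcongr h (hψ.lineDeriv _), hcongr (h.lineDeriv _) hψ, ← neg_smul]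
  simp_rw [hψ.lineDeriv_eq_fderiv, h.lineDeriv_eq_fderiv]
  rw [hparts, neg_neg]

/-- The element `y ↦ φ y • e` of `H¹(Ω; F)`. -/
def IsTestFunction.toH1 [CompleteSpace F] {Ω : Set (EuclideanSpace ℝ (Fin d))}
    {φ : EuclideanSpace ℝ (Fin d) → ℝ} (h : IsTestFunction Ω φ) (e : F) : H1 F Ω :=
  ⟨h.smulConst e, fun i => ⟨_, h.isWeakPartial_smulConst e i⟩⟩

/-- `weakPartial` is an arbitrary choice; uniqueness on the open set `Ω` forces it to be the
classical derivative. -/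
lemma IsTestFunction.weakPartial_toH1 [CompleteSpace F] {Ω : Set (EuclideanSpace ℝ (Fin d))}
    (hΩ : IsOpen Ω) {φ : EuclideanSpace ℝ (Fin d) → ℝ} (h : IsTestFunction Ω φ) (e : F)
    (i : Fin d) :
    weakPartial i (h.toH1 e) = (h.lineDeriv (EuclideanSpace.single i 1)).smulConst e :=
  (isWeakPartial_weakPartial i (h.toH1 e)).unique hΩ (h.isWeakPartial_smulConst e i)

lemma IsTestFunction.inner_smulConst_ae_eq {Ω : Set (EuclideanSpace ℝ (Fin d))}
    {φ : EuclideanSpace ℝ (Fin d) → ℝ} (h : IsTestFunction Ω φ) (e : F) (u : L2 F Ω) :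
    (fun y => inner ℝ (u y) (h.smulConst e y)) =ᵐ[volume.restrict Ω]
      fun y => inner ℝ e (φ y • u y) := by
  filter_upwards [h.coeFn_smulConst e] with y hy
  rw [hy, inner_smul_right, inner_smul_right, real_inner_comm]

lemma IsTestFunction.integral_inner_smulConst [CompleteSpace F]
    {Ω : Set (EuclideanSpace ℝ (Fin d))} {φ : EuclideanSpace ℝ (Fin d) → ℝ}
    (h : IsTestFunction Ω φ) (e : F) (u : L2 F Ω) :
    ∫ y in Ω, inner ℝ (u y) (h.smulConst e y) = inner ℝ e (∫ y in Ω, φ y • u y) := by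
  rw [integral_congr_ae (h.inner_smulConst_ae_eq e u), integral_inner (h.integrable_smul u)]

/-- The weak form of `-Δ`: the gradient part of the `H¹` inner product with a test function is the
`L²` pairing with minus its Laplacian. -/
lemma IsTestFunction.h1Inner_toH1 [CompleteSpace F] {Ω : Set (EuclideanSpace ℝ (Fin d))}
    (hΩ : IsOpen Ω) {φ : EuclideanSpace ℝ (Fin d) → ℝ} (h : IsTestFunction Ω φ) (e : F)
    (u : H1 F Ω) :
    h1Inner u (h.toH1 e) =
      inner ℝ e ((∫ y in Ω, φ y • (u : L2 F Ω) y) - ∫ y in Ω, Δ φ y • (u : L2 F Ω) y) := by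
  have hgrad : ∫ y in Ω, ∑ i, inner ℝ (weakPartial i u y) (weakPartial i (h.toH1 e) y) =
      -inner ℝ e (∫ y in Ω, Δ φ y • (u : L2 F Ω) y) := by
    simp_rw [h.weakPartial_toH1 hΩ, h.laplacian_eq_sum_lineDeriv, Finset.sum_smul]
    rw [integral_finsetSum _ fun i _ => (((h.lineDeriv _).integrable_smul
        (weakPartial i u)).const_inner e).congr ((h.lineDeriv _).inner_smulConst_ae_eq e _).symm,
      integral_finsetSum _ fun i _ => ((h.lineDeriv _).lineDeriv _).integrable_smul _,
      inner_sum, ← Finset.sum_neg_distrib]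
    refine Finset.sum_congr rfl fun i _ => ?_
    -- The weak derivative of `u` is tested against `∂ᵢφ`; its minus sign cancels the one in the
    -- claim.
    rw [(h.lineDeriv _).integral_inner_smulConst,
      isWeakPartial_weakPartial i u _ (h.lineDeriv _), inner_neg_right, neg_neg]
  rw [h1Inner, hgrad, inner_sub_right, sub_eq_add_neg]
  congr 1
  exact h.integral_inner_smulConst e _

/-- If the functional `v ↦ ⟪u, v⟫_{H¹}` is represented in `L²` by `g`, then `Δu = u - g` weakly. -/
lemma isWeakLaplacian_of_h1Inner_eq [CompleteSpace F] {Ω : Set (EuclideanSpace ℝ (Fin d))}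
    (hΩ : IsOpen Ω) {u : H1 F Ω} {g : L2 F Ω}
    (h : ∀ v : H1 F Ω, h1Inner u v = ∫ y in Ω, inner ℝ (g y) ((v : L2 F Ω) y)) :
    IsWeakLaplacian Ω (u : L2 F Ω) ((u : L2 F Ω) - g) := by
  intro φ hφ
  have hsub : ∫ y in Ω, φ y • ((u : L2 F Ω) - g : L2 F Ω) y =
      (∫ y in Ω, φ y • (u : L2 F Ω) y) - ∫ y in Ω, φ y • g y := by
    rw [← integral_sub (hφ.integrable_smul _) (hφ.integrable_smul g)]
    refine integral_congr_ae ?_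
    filter_upwards [Lp.coeFn_sub (u : L2 F Ω) g] with y hy
    rw [hy, Pi.sub_apply, smul_sub]
  have key : (∫ y in Ω, φ y • (u : L2 F Ω) y) - ∫ y in Ω, Δ φ y • (u : L2 F Ω) y =
      ∫ y in Ω, φ y • g y :=
    ext_inner_left ℝ fun e => by
      rw [← hφ.h1Inner_toH1 hΩ, h, ← hφ.integral_inner_smulConst]
      rfl
  rw [hsub, ← key, sub_sub_cancel]

end SobolevSmoothing

end

theorem theorem3 {d : ℕ} {F : Type*} [NormedAddCommGroup F] [InnerProductSpace ℝ F]
    [FiniteDimensional ℝ F]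
    (Ω : Set (EuclideanSpace ℝ (Fin d))) (hΩ : IsOpen Ω)
    (n : EuclideanSpace ℝ (Fin d) → EuclideanSpace ℝ (Fin d))
    (hn : ∀ᵐ z ∂(SobolevSmoothing.surfaceMeasure Ω),
      SobolevSmoothing.IsOuterUnitNormal Ω z (n z))
    (f : SobolevSmoothing.H1 F Ω → ℝ) (x : SobolevSmoothing.H1 F Ω)
    (gradL : SobolevSmoothing.L2 F Ω) (hL : SobolevSmoothing.IsL2Gradient f x gradL)
    (gradH : SobolevSmoothing.H1 F Ω) (hH : SobolevSmoothing.IsH1Gradient f x gradH)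
    (hNeumann : ∀ᵐ z ∂(SobolevSmoothing.surfaceMeasure Ω),
      SobolevSmoothing.HasNormalDerivAt gradH 0 z (n z)) :
    ∃ lapH : SobolevSmoothing.L2 F Ω,
      SobolevSmoothing.IsWeakLaplacian Ω (gradH : SobolevSmoothing.L2 F Ω) lapH ∧
      ∀ᵐ y ∂(volume.restrict Ω), (gradH : SobolevSmoothing.L2 F Ω) y - lapH y = gradL y := by
  -- The witness is the value of `Δu` that the equation itself dictates.
  refine ⟨(gradH : SobolevSmoothing.L2 F Ω) - gradL,
    SobolevSmoothing.isWeakLaplacian_of_h1Inner_eq hΩ fun v => (hH v).unique (hL v), ?_⟩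
  filter_upwards [Lp.coeFn_sub (gradH : SobolevSmoothing.L2 F Ω) gradL] with y hy
  rw [hy, Pi.sub_apply, sub_sub_cancel]
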